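/- Let $n\ge 0$ and let $(\mathbf C^2)^{\otimes n}=\bigoplus_i E_i$ be any decomposition into pairwise orthogonal one-dimensional subspaces (that is, a projective measurement in an arbitrary fixed orthonormal basis). A circuit on $n$ qubits is a finite sequence of gates, each of which is either an arbitrary unitary one-qubit gate applied to one of the qubits or a CNOT gate between two distinct qubits. A circuit simulates a unitary operator $u$ up to the measurement if the operator it computes equals, up to a global phase, a unitary operator $w$ such that, for every input state $\psi$ and every $i$, the probability that the measurement of $w\psi$ gives the outcome $E_i$ equals the probability that the measurement of $u\psi$ gives $E_i$. Then, to simulate an arbitrary $n$-qubit operator up to this measurement, at least $\lceil (4^n-2^n-3n)/4\rceil$ CNOT gates are required: there is a unitary operator $u$ on $(\mathbf C^2)^{\otimes n}$ such that every circuit that simulates $u$ up to the measurement contains at least $\lceil (4^n-2^n-3n)/4\rceil$ CNOT gates. -/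

import Mathlib

/-- The state space `(ℂ²)^{⊗n}` of `n` qubits, written in coordinates with respect to the
computational basis, whose vectors are indexed by the bit strings `Fin n → Fin 2`. -/
abbrev QState (n : ℕ) : Type := EuclideanSpace ℂ (Fin n → Fin 2)

/-- Matrices, in the computational basis, of linear operators on `n` qubits. -/
abbrev QMatrix (n : ℕ) : Type := Matrix (Fin n → Fin 2) (Fin n → Fin 2) ℂ

/-- The operator `I ⊗ ⋯ ⊗ a ⊗ ⋯ ⊗ I` that applies the one-qubit operator `a` to qubit `q`. -/
def oneQubitMatrix {n : ℕ} (q : Fin n) (a : Matrix (Fin 2) (Fin 2) ℂ) : QMatrix n :=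
  Matrix.of fun x y => if ∀ j, j ≠ q → x j = y j then a (x q) (y q) else 0

/-- The `CNOT` with control `c` and target `t`: the basis vector `|y⟩` is sent to the basis vector
in which bit `t` of `y` is replaced by `y t + y c` (addition modulo two). -/
def cnotMatrix {n : ℕ} (c t : Fin n) : QMatrix n :=
  Matrix.of fun x y => if x = Function.update y t (y t + y c) then 1 else 0

/-- The gates of a basic circuit on `n` qubits: arbitrary unitary one-qubit gates on any qubit, and
`CNOT` gates between any two distinct qubits. -/
inductive QGate (n : ℕ) : Type
  | oneQubit (q : Fin n) (a : Matrix.unitaryGroup (Fin 2) ℂ) : QGate n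
  | cnot (c t : Fin n) (hct : c ≠ t) : QGate n

/-- The operator that a gate applies to the `n` qubits. -/
def QGate.toMatrix {n : ℕ} : QGate n → QMatrix n
  | .oneQubit q a => oneQubitMatrix q (a : Matrix (Fin 2) (Fin 2) ℂ)
  | .cnot c t _ => cnotMatrix c t

/-- A circuit on `n` qubits: the finite list of its gates, the gate applied first standing first. -/
abbrev QCircuit (n : ℕ) : Type := List (QGate n)

/-- The operator computed by a circuit. -/
def QCircuit.toMatrix {n : ℕ} : QCircuit n → QMatrix n
  | [] => 1
  | g :: C => QCircuit.toMatrix C * g.toMatrix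

/-- The number of `CNOT` gates in a circuit. -/
def QCircuit.cnotCount {n : ℕ} : QCircuit n → ℕ
  | [] => 0
  | .oneQubit _ _ :: C => QCircuit.cnotCount C
  | .cnot _ _ _ :: C => QCircuit.cnotCount C + 1

/-- The state obtained by applying the operator with matrix `u` to the state `ψ`. -/
def applyOp {n : ℕ} (u : QMatrix n) (ψ : QState n) : QState n :=
  WithLp.toLp 2 (Matrix.mulVec u ψ.ofLp)

/-- The subspaces `E i` form an orthogonal decomposition of the state space: they are pairwise
orthogonal and span it. -/
def IsOrthogonalDecomposition {n : ℕ} {ι : Type*} (E : ι → Submodule ℂ (QState n)) : Prop :=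
  (∀ i j, i ≠ j → E i ⟂ E j) ∧ ⨆ i, E i = ⊤

/-- The probability that the projective measurement of the (unit) state `ψ` finds it in the
subspace `F`: the squared norm of the orthogonal projection of `ψ` onto `F`. -/
noncomputable def measureProb {n : ℕ} (F : Submodule ℂ (QState n)) (ψ : QState n) : ℝ :=
  ‖F.starProjection ψ‖ ^ 2

/-- `w` and `u` agree after the projective measurement given by `E`: on every input state, every
outcome of the measurement is equally probable after `w` and after `u`. -/
def AgreeAfterMeasurement {n : ℕ} {ι : Type*} (E : ι → Submodule ℂ (QState n))
    (w u : QMatrix n) : Prop :=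
  ∀ ψ : QState n, ‖ψ‖ = 1 → ∀ i, measureProb (E i) (applyOp w ψ) = measureProb (E i) (applyOp u ψ)

/-- The circuit `C` simulates the operator `w` up to global phase. -/
def QCircuit.Simulates {n : ℕ} (C : QCircuit n) (w : QMatrix n) : Prop :=
  ∃ θ : ℝ, C.toMatrix = Complex.exp (θ * Complex.I) • w

/-- The circuit `C` simulates the operator `u` up to the measurement don't-care associated to the
decomposition `E`: it simulates, up to global phase, some unitary operator `w` that agrees with `u`
after the measurement. -/
def QCircuit.SimulatesUpToMeasurement {n : ℕ} {ι : Type*} (C : QCircuit n)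
    (E : ι → Submodule ℂ (QState n)) (u : QMatrix n) : Prop :=
  ∃ w ∈ Matrix.unitaryGroup (Fin n → Fin 2) ℂ, AgreeAfterMeasurement E w u ∧ C.Simulates w

/-! The theorem is a dimension count. The unitary group on `n` qubits has real dimension `4 ^ n`,
whereas circuits with `k` `CNOT`s, taken up to the measurement, lie in countably many smooth
families with only `2 ^ n + 4 * k + 3 * n` parameters.

The term `4 * k` comes from a normal form (`QCircuit.exists_toMatrix_eq`). Up to phase, a one-qubit
unitary has three Euler parameters. One of them can be chosen to commute with the control, or with
the target, of an adjacent `CNOT`, and so be pushed through it. Each `CNOT` thus retains two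
parameters on each of its two qubits. What remains is one local layer, with `3 * n` parameters.

The term `2 ^ n` comes from the measurement: `w` and `u` have the same outcome probabilities only if
`u = D * w` with `D` unitary and diagonal in the measured basis (`exists_eq_diagonalFamily_mul`).
`D` also absorbs every global phase.

If each unitary had a circuit below the bound, the unitary group would be covered by countably many
C¹ images of spaces of dimension less than `4 ^ n`. A Cayley chart turns this into a cover of
`ℝ^(4^n)`, which Hausdorff dimension forbids (`SmoothlyCovered.card_sq_le`). -/

open scoped Matrix

/-! ### Sets of matrices covered by smooth families -/

/-- The set `S` of matrices is contained in a countable union of images of maps from `ℝ^d` whose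
entries are continuously differentiable. -/
def SmoothlyCovered {I : Type*} (d : ℕ) (S : Set (Matrix I I ℂ)) : Prop :=
  ∃ (J : Type) (_ : Countable J) (F : J → (Fin d → ℝ) → Matrix I I ℂ),
    (∀ m x y, ContDiff ℝ 1 fun p => F m p x y) ∧ ∀ A ∈ S, ∃ m p, F m p = A

namespace SmoothlyCovered

variable {I : Type*} {d e : ℕ} {S T : Set (Matrix I I ℂ)}

theorem mono (hT : SmoothlyCovered d T) (h : S ⊆ T) : SmoothlyCovered d S := by
  obtain ⟨J, hJ, F, hF, hS⟩ := hT
  exact ⟨J, hJ, F, hF, fun A hA => hS A (h hA)⟩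

theorem range {P : Type*} [Fintype P] (hd : Fintype.card P = d) (F : (P → ℝ) → Matrix I I ℂ)
    (hF : ∀ x y, ContDiff ℝ 1 fun p => F p x y) : SmoothlyCovered d (Set.range F) := by
  have σ : P ≃ Fin d := Fintype.equivFinOfCardEq hd
  refine ⟨Unit, inferInstance, fun _ p => F (fun i => p (σ i)), fun _ x y => ?_, ?_⟩
  · exact (hF x y).comp (by fun_prop : ContDiff ℝ 1 fun p : Fin d → ℝ => fun i => p (σ i))
  · rintro _ ⟨p, rfl⟩
    exact ⟨(), fun i => p (σ.symm i), by simp⟩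

theorem singleton (A : Matrix I I ℂ) : SmoothlyCovered 0 {A} :=
  ⟨Unit, inferInstance, fun _ _ => A, fun _ _ _ => contDiff_const, by
    rintro _ rfl; exact ⟨(), 0, rfl⟩⟩

theorem iUnion {K : Type} [Countable K] {S : K → Set (Matrix I I ℂ)}
    (h : ∀ k, SmoothlyCovered d (S k)) : SmoothlyCovered d (⋃ k, S k) := by
  choose J hJ F hF hS using h
  refine ⟨Σ k, J k, inferInstance, fun m => F m.1 m.2, fun m => hF m.1 m.2, fun A hA => ?_⟩
  obtain ⟨k, hk⟩ := Set.mem_iUnion.1 hA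
  obtain ⟨m, p, hp⟩ := hS k A hk
  exact ⟨⟨k, m⟩, p, hp⟩

theorem mul [Fintype I] (hS : SmoothlyCovered d S) (hT : SmoothlyCovered e T) :
    SmoothlyCovered (d + e) {C | ∃ A ∈ S, ∃ B ∈ T, A * B = C} := by
  obtain ⟨J, hJ, F, hF, hS⟩ := hS
  obtain ⟨K, hK, G, hG, hT⟩ := hT
  refine ⟨J × K, inferInstance, fun m p =>
    F m.1 (fun i => p (Fin.castAdd e i)) * G m.2 (fun i => p (Fin.natAdd d i)), ?_, ?_⟩
  · intro m x y
    simp only [Matrix.mul_apply]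
    refine ContDiff.sum fun z _ => ContDiff.mul ?_ ?_
    · exact (hF m.1 x z).comp
        (by fun_prop : ContDiff ℝ 1 fun p : Fin (d + e) → ℝ => fun i => p (Fin.castAdd e i))
    · exact (hG m.2 z y).comp
        (by fun_prop : ContDiff ℝ 1 fun p : Fin (d + e) → ℝ => fun i => p (Fin.natAdd d i))
  · rintro _ ⟨A, hA, B, hB, rfl⟩
    obtain ⟨j, p, rfl⟩ := hS A hA
    obtain ⟨k, q, rfl⟩ := hT B hB
    exact ⟨(j, k), Fin.append p q, by simp⟩

end SmoothlyCovered

/-! ### The unitary group is not covered by low-dimensional families -/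

theorem contDiff_matrix_det {I E : Type*} [Fintype I] [DecidableEq I] [NormedAddCommGroup E]
    [NormedSpace ℝ E] {F : E → Matrix I I ℂ} (hF : ∀ x y, ContDiff ℝ 1 fun p => F p x y) :
    ContDiff ℝ 1 fun p => (F p).det := by
  simp only [Matrix.det_apply]
  exact ContDiff.sum fun σ _ => ContDiff.const_smul _ (contDiff_prod fun i _ => hF _ _)

theorem contDiff_matrix_adjugate {I E : Type*} [Fintype I] [DecidableEq I] [NormedAddCommGroup E]
    [NormedSpace ℝ E] {F : E → Matrix I I ℂ} (hF : ∀ x y, ContDiff ℝ 1 fun p => F p x y)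
    (x y : I) : ContDiff ℝ 1 fun p => (F p).adjugate x y := by
  simp only [Matrix.adjugate_apply]
  refine contDiff_matrix_det fun i j => ?_
  by_cases h : i = y
  · subst h; simpa using contDiff_const
  · simpa [Matrix.updateRow_ne h] using hF i j

/-- The Cayley transform, followed by the real-linear map adding real and imaginary parts
entrywise. -/
noncomputable def realCayley {I : Type*} [Fintype I] [DecidableEq I] (U : Matrix I I ℂ) :
    I × I → ℝ :=
  fun ij => (((1 - U) * (1 + U)⁻¹) ij.1 ij.2).re + (((1 - U) * (1 + U)⁻¹) ij.1 ij.2).im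

/-- By Cramer's rule the inverse is adjugate over determinant, hence C¹ wherever the determinant
does not vanish. -/
theorem contDiffAt_realCayley {I E : Type*} [Fintype I] [DecidableEq I] [NormedAddCommGroup E]
    [NormedSpace ℝ E] {F : E → Matrix I I ℂ} (hF : ∀ x y, ContDiff ℝ 1 fun p => F p x y)
    {p : E} (hp : (1 + F p).det ≠ 0) : ContDiffAt ℝ 1 (fun p => realCayley (F p)) p := by
  have hadd : ∀ x y, ContDiff ℝ 1 fun p => (1 + F p) x y := fun x y => by
    simpa using contDiff_const.add (hF x y)
  have hsub : ∀ x y, ContDiff ℝ 1 fun p => (1 - F p) x y := fun x y => by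
    simpa using contDiff_const.sub (hF x y)
  have hK : ∀ x y, ContDiffAt ℝ 1 (fun p => ((1 - F p) * (1 + F p)⁻¹) x y) p := fun x y => by
    simp only [Matrix.inv_def, Matrix.mul_apply, Matrix.smul_apply, smul_eq_mul,
      Ring.inverse_eq_inv']
    exact ContDiffAt.sum fun z _ => (hsub x z).contDiffAt.mul
      (((contDiff_matrix_det hadd).contDiffAt.inv hp).mul
        (contDiff_matrix_adjugate hadd z y).contDiffAt)
  refine contDiffAt_pi.2 fun ij => ?_
  exact (Complex.reCLM.contDiff.contDiffAt.comp p (hK ij.1 ij.2)).add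
    (Complex.imCLM.contDiff.contDiffAt.comp p (hK ij.1 ij.2))

open scoped ComplexOrder in
-- A skew-Hermitian `K` has antisymmetric real part and symmetric imaginary part, so the sum of the
-- two can be any real matrix and determines `K`. The Cayley transform is an involution, so `U` is
-- taken to be the transform of `K`. Both `1 + K` and `1 - K` are invertible because their product
-- `1 + Kᴴ * K` is positive definite.
theorem exists_unitary_realCayley_eq {I : Type*} [Fintype I] [DecidableEq I] (R : I × I → ℝ) :
    ∃ U ∈ Matrix.unitaryGroup I ℂ, (1 + U).det ≠ 0 ∧ realCayley U = R := by
  let K : Matrix I I ℂ := Matrix.of fun i j =>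
    ⟨(R (i, j) - R (j, i)) / 2, (R (i, j) + R (j, i)) / 2⟩
  have hK : Kᴴ = -K := by
    ext i j
    apply Complex.ext <;> simp [K] <;> ring
  have hpos : (1 + Kᴴ * K).PosDef :=
    Matrix.PosDef.one.add_posSemidef (Matrix.posSemidef_conjTranspose_mul_self K)
  have hmul : (1 + K) * (1 - K) = 1 + Kᴴ * K := by
    rw [hK]; noncomm_ring
  have hdet : (1 + K).det * (1 - K).det ≠ 0 := by
    rw [← Matrix.det_mul, hmul]; exact hpos.det_pos.ne'
  have hp : IsUnit (1 + K).det := (left_ne_zero_of_mul hdet).isUnit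
  have hm : IsUnit (1 - K).det := (right_ne_zero_of_mul hdet).isUnit
  have hcomm : (1 + K) * (1 - K) = (1 - K) * (1 + K) := by noncomm_ring
  have h1 : 1 + (1 - K) * (1 + K)⁻¹ = (2 : ℂ) • (1 + K)⁻¹ := by
    nth_rewrite 1 [← Matrix.mul_nonsing_inv _ hp]
    rw [← add_mul, two_smul]; noncomm_ring
  have h2 : 1 - (1 - K) * (1 + K)⁻¹ = (2 : ℂ) • (K * (1 + K)⁻¹) := by
    nth_rewrite 1 [← Matrix.mul_nonsing_inv _ hp]
    rw [← sub_mul, two_smul]; noncomm_ring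
  refine ⟨(1 - K) * (1 + K)⁻¹, ?_, ?_, ?_⟩
  · rw [Matrix.mem_unitaryGroup_iff, Matrix.star_eq_conjTranspose, Matrix.conjTranspose_mul,
      Matrix.conjTranspose_nonsing_inv]
    simp only [Matrix.conjTranspose_add, Matrix.conjTranspose_sub, Matrix.conjTranspose_one, hK]
    rw [← sub_eq_add_neg, sub_neg_eq_add, Matrix.mul_assoc, ← Matrix.mul_assoc (1 + K)⁻¹,
      ← Matrix.mul_inv_rev, ← hcomm, Matrix.mul_inv_rev, Matrix.mul_assoc,
      Matrix.nonsing_inv_mul _ hp, Matrix.mul_one, Matrix.mul_nonsing_inv _ hm]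
  · rw [h1, Matrix.det_smul]
    exact mul_ne_zero (by simp) (Matrix.isUnit_nonsing_inv_det _ hp).ne_zero
  · have hinv : ((2 : ℂ) • (1 + K)⁻¹)⁻¹ = (2⁻¹ : ℂ) • (1 + K) := by
      apply Matrix.inv_eq_right_inv
      rw [Matrix.smul_mul, Matrix.mul_smul, smul_smul, Matrix.nonsing_inv_mul _ hp]
      norm_num
    have hcay : (1 - (1 - K) * (1 + K)⁻¹) * (1 + (1 - K) * (1 + K)⁻¹)⁻¹ = K := by
      rw [h1, h2, hinv, Matrix.smul_mul, Matrix.mul_smul, smul_smul, Matrix.mul_assoc,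
        Matrix.nonsing_inv_mul _ hp]
      norm_num
    funext ⟨i, j⟩
    simp only [realCayley, hcay]
    simp only [K, Matrix.of_apply]
    ring

/-- C¹ maps are locally Lipschitz and so do not raise Hausdorff dimension, and a countable union has
the supremum of the dimensions of its members. -/
theorem SmoothlyCovered.card_sq_le {I : Type*} [Fintype I] [DecidableEq I] {K : Type}
    [Countable K] {d : ℕ} {D : K → ℕ} {S : K → Set (Matrix I I ℂ)}
    (hS : ∀ k, SmoothlyCovered (D k) (S k)) (hD : ∀ k, D k ≤ d)
    (hU : ∀ U ∈ Matrix.unitaryGroup I ℂ, ∃ k, U ∈ S k) : Fintype.card I ^ 2 ≤ d := by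
  choose J hJ F hF hS using hS
  let s : (m : Σ k, J k) → Set (Fin (D m.1) → ℝ) := fun m => {p | (1 + F m.1 m.2 p).det ≠ 0}
  have huniv : (Set.univ : Set (I × I → ℝ)) ⊆
      ⋃ m : Σ k, J k, (fun p => realCayley (F m.1 m.2 p)) '' s m := by
    intro R _
    obtain ⟨U, hUu, hdet, rfl⟩ := exists_unitary_realCayley_eq R
    obtain ⟨k, hk⟩ := hU U hUu
    obtain ⟨m, p, rfl⟩ := hS k U hk
    exact Set.mem_iUnion.2 ⟨⟨k, m⟩, p, hdet, rfl⟩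
  have hle : dimH (Set.univ : Set (I × I → ℝ)) ≤ d := by
    refine (dimH_mono huniv).trans ?_
    rw [dimH_iUnion]
    refine iSup_le fun m => ?_
    refine (dimH_image_le_of_locally_lipschitzOn fun p hp => ?_).trans
      ((dimH_mono (Set.subset_univ _)).trans ?_)
    · obtain ⟨C, t, ht, hL⟩ := (contDiffAt_realCayley (hF m.1 m.2) hp).exists_lipschitzOnWith
      exact ⟨C, t, mem_nhdsWithin_of_mem_nhds ht, hL⟩
    · rw [Real.dimH_univ_pi_fin]
      exact_mod_cast hD m.1
  rw [Real.dimH_univ_pi, Fintype.card_prod] at hle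
  rw [sq]
  exact_mod_cast hle

/-! ### Tensor products of one-qubit operators -/

/-- The tensor product of one-qubit operators. -/
def tensorMatrix {n : ℕ} (a : Fin n → Matrix (Fin 2) (Fin 2) ℂ) : QMatrix n :=
  Matrix.of fun x y => ∏ q, a q (x q) (y q)

theorem tensorMatrix_mul {n : ℕ} (a b : Fin n → Matrix (Fin 2) (Fin 2) ℂ) :
    tensorMatrix a * tensorMatrix b = tensorMatrix fun q => a q * b q := by
  ext x y
  simp only [tensorMatrix, Matrix.mul_apply, Matrix.of_apply, Finset.prod_univ_sum,
    Fintype.piFinset_univ, Finset.prod_mul_distrib]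

theorem tensorMatrix_smul {n : ℕ} (z : Fin n → ℂ) (a : Fin n → Matrix (Fin 2) (Fin 2) ℂ) :
    (tensorMatrix fun q => z q • a q) = (∏ q, z q) • tensorMatrix a := by
  ext x y
  simp [tensorMatrix, Finset.prod_mul_distrib]

theorem tensorMatrix_one {n : ℕ} : tensorMatrix (fun _ : Fin n => 1) = 1 := by
  ext x y
  simp [tensorMatrix, Matrix.one_apply, Finset.prod_ite_zero, funext_iff]

theorem oneQubitMatrix_eq_tensorMatrix {n : ℕ} (q : Fin n) (a : Matrix (Fin 2) (Fin 2) ℂ) :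
    oneQubitMatrix q a = tensorMatrix (Function.update (fun _ => 1) q a) := by
  ext x y
  have h : ∏ j ∈ Finset.univ.erase q,
      (Function.update (fun _ : Fin n => (1 : Matrix (Fin 2) (Fin 2) ℂ)) q a) j (x j) (y j) =
      if ∀ j, j ≠ q → x j = y j then 1 else 0 := by
    rw [Finset.prod_congr rfl (g := fun j => if x j = y j then (1 : ℂ) else 0)]
    · simp [Finset.prod_ite_zero]
    · intro j hj
      rw [Function.update_of_ne (Finset.ne_of_mem_erase hj), Matrix.one_apply]
  simp only [tensorMatrix, oneQubitMatrix, Matrix.of_apply]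
  rw [← Finset.mul_prod_erase _ _ (Finset.mem_univ q), h]
  simp

/-- A `CNOT` applies a power of the bit flip to the target, selected by the control bit. It
therefore commutes with diagonal operators on the control (`hc`) and with operators on the target
that commute with the flip (`ht`). -/
theorem tensorMatrix_mul_cnotMatrix_comm {n : ℕ} {c t : Fin n} (hct : c ≠ t)
    {a : Fin n → Matrix (Fin 2) (Fin 2) ℂ} (hc : ∀ i j, i ≠ j → a c i j = 0)
    (ht : ∀ i j s, a t i (j + s) = a t (i + s) j) :
    tensorMatrix a * cnotMatrix c t = cnotMatrix c t * tensorMatrix a := by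
  ext x y
  have hz : ∀ i s : Fin 2, i + s + s = i := by decide
  have hinv : ∀ z : Fin n → Fin 2, x = Function.update z t (z t + z c) ↔
      z = Function.update x t (x t + x c) := by
    intro z
    constructor
    · rintro rfl
      simp [Function.update_of_ne hct, hz]
    · rintro rfl
      simp [Function.update_of_ne hct, hz]
  simp only [Matrix.mul_apply, cnotMatrix, tensorMatrix, Matrix.of_apply, mul_ite, mul_one,
    mul_zero, ite_mul, one_mul, zero_mul, hinv, Finset.sum_ite_eq', Finset.mem_univ, if_true]
  by_cases hxy : x c = y c
  · refine Finset.prod_congr rfl fun q _ => ?_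
    by_cases hq : q = t
    · subst hq
      simp [ht, hxy]
    · simp [Function.update_of_ne hq]
  · rw [Finset.prod_eq_zero (Finset.mem_univ c), Finset.prod_eq_zero (Finset.mem_univ c)]
    · rw [Function.update_of_ne hct]; exact hc _ _ hxy
    · rw [Function.update_of_ne hct]; exact hc _ _ hxy

/-! ### Decomposition of one-qubit operators -/

/-- The one-qubit phase gate. -/
noncomputable def phaseGate (θ : ℝ) : Matrix (Fin 2) (Fin 2) ℂ :=
  !![1, 0; 0, Complex.exp (θ * Complex.I)]

/-- The one-qubit real rotation. -/
noncomputable def rotationGate (θ : ℝ) : Matrix (Fin 2) (Fin 2) ℂ :=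
  !![Complex.cos θ, Complex.sin θ; -Complex.sin θ, Complex.cos θ]

/-- The Hadamard gate. -/
noncomputable def hadamardGate : Matrix (Fin 2) (Fin 2) ℂ :=
  ((Real.sqrt 2)⁻¹ : ℂ) • !![1, 1; 1, -1]

theorem hadamardGate_mul_self : hadamardGate * hadamardGate = 1 := by
  have h : ((Real.sqrt 2 : ℝ) : ℂ)⁻¹ * ((Real.sqrt 2 : ℝ) : ℂ)⁻¹ = 2⁻¹ := by
    rw [← mul_inv, ← Complex.ofReal_mul, Real.mul_self_sqrt (by norm_num)]; norm_num
  rw [hadamardGate, Matrix.smul_mul, Matrix.mul_smul, smul_smul, h]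
  ext i j
  fin_cases i <;> fin_cases j <;> simp <;> norm_num

theorem hadamardGate_mem_unitaryGroup : hadamardGate ∈ Matrix.unitaryGroup (Fin 2) ℂ := by
  rw [Matrix.mem_unitaryGroup_iff]
  have : star hadamardGate = hadamardGate := by
    ext i j
    fin_cases i <;> fin_cases j <;> simp [hadamardGate]
  rw [this, hadamardGate_mul_self]

theorem phaseGate_mem_unitaryGroup (θ : ℝ) : phaseGate θ ∈ Matrix.unitaryGroup (Fin 2) ℂ := by
  rw [Matrix.mem_unitaryGroup_iff]
  ext i j
  fin_cases i <;> fin_cases j <;>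
    simp [phaseGate, Matrix.mul_apply, Complex.mul_conj, Complex.normSq_eq_norm_sq]

/-- The moduli of the first row give `β` and its phases give `w` and `γ`. The second row is
orthogonal to the first, which leaves only a phase, `α`. -/
theorem exists_eq_smul_phaseGate_mul {a : Matrix (Fin 2) (Fin 2) ℂ}
    (ha : a ∈ Matrix.unitaryGroup (Fin 2) ℂ) :
    ∃ (w : ℂ) (α β γ : ℝ), ‖w‖ = 1 ∧
      a = w • (phaseGate α * rotationGate β * phaseGate γ) := by
  have hu := (Matrix.mem_unitaryGroup_iff).1 ha
  have h00 := congrFun₂ hu 0 0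
  have h10 := congrFun₂ hu 1 0
  have h11 := congrFun₂ hu 1 1
  simp only [Matrix.mul_apply, Fin.sum_univ_two, Matrix.star_apply, Matrix.one_apply_eq,
    RCLike.star_def, Complex.mul_conj, Complex.normSq_eq_norm_sq] at h00 h11
  simp only [Matrix.mul_apply, Fin.sum_univ_two, Matrix.star_apply, RCLike.star_def] at h10
  rw [Matrix.one_apply_ne (by decide)] at h10
  have e00 : ‖a 0 0‖ ^ 2 + ‖a 0 1‖ ^ 2 = 1 := by exact_mod_cast h00
  have e11 : ‖a 1 0‖ ^ 2 + ‖a 1 1‖ ^ 2 = 1 := by exact_mod_cast h11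
  obtain ⟨μ, hμ⟩ : ∃ μ : ℝ, a 0 0 = ‖a 0 0‖ * Complex.exp (μ * Complex.I) :=
    ⟨_, (Complex.norm_mul_exp_arg_mul_I _).symm⟩
  obtain ⟨ν, hν⟩ : ∃ ν : ℝ, a 0 1 = ‖a 0 1‖ * Complex.exp (ν * Complex.I) :=
    ⟨_, (Complex.norm_mul_exp_arg_mul_I _).symm⟩
  obtain ⟨β, hcos, hsin⟩ : ∃ β : ℝ, Real.cos β = ‖a 0 0‖ ∧ Real.sin β = ‖a 0 1‖ := by
    refine ⟨Real.arccos ‖a 0 0‖, Real.cos_arccos ?_ ?_, ?_⟩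
    · linarith [norm_nonneg (a 0 0)]
    · nlinarith [norm_nonneg (a 0 0), sq_nonneg ‖a 0 1‖]
    · rw [Real.sin_arccos, ← e00, add_sub_cancel_left, Real.sqrt_sq (norm_nonneg _)]
  have hcs : Complex.cos β ^ 2 + Complex.sin β ^ 2 = 1 := Complex.cos_sq_add_sin_sq _
  rw [← hcos, Complex.ofReal_cos] at hμ
  rw [← hsin, Complex.ofReal_sin] at hν
  have hconj : ∀ θ : ℝ, (starRingEnd ℂ) (Complex.exp (θ * Complex.I)) =
      Complex.exp (-(θ * Complex.I)) := fun θ => by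
    rw [← Complex.exp_conj]; simp
  have hmul : ∀ θ : ℝ, Complex.exp (θ * Complex.I) * Complex.exp (-(θ * Complex.I)) = 1 :=
    fun θ => by rw [← Complex.exp_add]; simp
  rw [hμ, hν, map_mul, map_mul, hconj, hconj, ← Complex.cos_conj, ← Complex.sin_conj,
    Complex.conj_ofReal] at h10
  -- The coefficient of the second row along the unit vector `(-sin β e^{iμ}, cos β e^{iν})`, which
  -- is orthogonal to the first row.
  set W : ℂ := Complex.cos β * a 1 1 * Complex.exp (-(ν * Complex.I)) -
    Complex.sin β * a 1 0 * Complex.exp (-(μ * Complex.I)) with hW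
  have r1 : a 1 1 = W * Complex.cos β * Complex.exp (ν * Complex.I) := by
    rw [hW]
    linear_combination (-a 1 1) * hcs -
      (Complex.cos β ^ 2 + Complex.sin β ^ 2) * a 1 1 * hmul ν +
      Complex.sin β * Complex.exp (ν * Complex.I) * h10
  have r0 : a 1 0 = -W * Complex.sin β * Complex.exp (μ * Complex.I) := by
    rw [hW]
    linear_combination (-a 1 0) * hcs -
      (Complex.cos β ^ 2 + Complex.sin β ^ 2) * a 1 0 * hmul μ +
      Complex.cos β * Complex.exp (μ * Complex.I) * h10
  have hWn : ‖W‖ = 1 := by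
    rw [r0, r1] at e11
    simp only [norm_mul, norm_neg, Complex.norm_exp_ofReal_mul_I, mul_one, ← Complex.ofReal_cos,
      ← Complex.ofReal_sin, Complex.norm_real, mul_pow, Real.norm_eq_abs, sq_abs] at e11
    have : ‖W‖ ^ 2 = 1 := by
      linear_combination e11 - ‖W‖ ^ 2 * Real.cos_sq_add_sin_sq β
    nlinarith [norm_nonneg W]
  obtain ⟨α, hα⟩ : ∃ α : ℝ, W = Complex.exp (α * Complex.I) :=
    ⟨W.arg, by simpa [hWn] using (Complex.norm_mul_exp_arg_mul_I W).symm⟩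
  have hνμ : Complex.exp (ν * Complex.I) =
      Complex.exp (μ * Complex.I) * Complex.exp (((ν - μ : ℝ) : ℂ) * Complex.I) := by
    rw [← Complex.exp_add]; push_cast; ring_nf
  refine ⟨Complex.exp (μ * Complex.I), α, β, ν - μ, Complex.norm_exp_ofReal_mul_I _, ?_⟩
  rw [hα] at r0 r1
  rw [hνμ] at r1 hν
  ext i j
  fin_cases i <;> fin_cases j <;>
    simp only [phaseGate, rotationGate, Fin.zero_eta, Fin.mk_one, Matrix.smul_apply,
      Matrix.mul_apply, Fin.sum_univ_two, smul_eq_mul, Matrix.of_apply, Matrix.cons_val_zero,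
      Matrix.cons_val_one, Matrix.cons_val', Matrix.cons_val_fin_one]
  · rw [hμ]; ring
  · rw [hν]; ring
  · rw [r0]; ring
  · rw [r1]; ring

theorem contDiff_matrix_mul {I E : Type*} [Fintype I] [NormedAddCommGroup E]
    [NormedSpace ℝ E] {F G : E → Matrix I I ℂ} (hF : ∀ x y, ContDiff ℝ 1 fun p => F p x y)
    (hG : ∀ x y, ContDiff ℝ 1 fun p => G p x y) (x y : I) :
    ContDiff ℝ 1 fun p => (F p * G p) x y := by
  simp only [Matrix.mul_apply]
  exact ContDiff.sum fun z _ => (hF x z).mul (hG z y)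

theorem contDiff_cexp_mul_I : ContDiff ℝ 1 fun θ : ℝ => Complex.exp (θ * Complex.I) :=
  (Complex.ofRealCLM.contDiff.mul contDiff_const).cexp

theorem contDiff_phaseGate (i j : Fin 2) : ContDiff ℝ 1 fun θ => phaseGate θ i j := by
  fin_cases i <;> fin_cases j <;> simp only [phaseGate, Fin.zero_eta, Fin.mk_one,
    Matrix.of_apply, Matrix.cons_val_zero, Matrix.cons_val_one, Matrix.cons_val',
    Matrix.cons_val_fin_one]
  · exact contDiff_const
  · exact contDiff_const
  · exact contDiff_const
  · exact contDiff_cexp_mul_I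

theorem contDiff_rotationGate (i j : Fin 2) : ContDiff ℝ 1 fun θ => rotationGate θ i j := by
  have hc : ContDiff ℝ 1 fun θ : ℝ => Complex.cos θ := by
    simp only [← Complex.ofReal_cos]
    exact Complex.ofRealCLM.contDiff.comp Real.contDiff_cos
  have hs : ContDiff ℝ 1 fun θ : ℝ => Complex.sin θ := by
    simp only [← Complex.ofReal_sin]
    exact Complex.ofRealCLM.contDiff.comp Real.contDiff_sin
  fin_cases i <;> fin_cases j <;> simp only [rotationGate, Fin.zero_eta, Fin.mk_one,
    Matrix.of_apply, Matrix.cons_val_zero, Matrix.cons_val_one, Matrix.cons_val',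
    Matrix.cons_val_fin_one]
  · exact hc
  · exact hs
  · exact hs.neg
  · exact hc

/-! ### Normal form of circuits -/

/-- A `CNOT` preceded by one-qubit operators on its control and its target, each of which is taken
from a two-parameter family. -/
noncomputable def cnotBlock {n : ℕ} (c t : Fin n) (p : Fin 4 → ℝ) : QMatrix n :=
  oneQubitMatrix c (phaseGate (p 0) * rotationGate (p 1)) *
    oneQubitMatrix t (hadamardGate * (phaseGate (p 2) * rotationGate (p 3)) * hadamardGate) *
    cnotMatrix c t

/-- The products of `k` matrices of the form `cnotBlock c t p`. -/
noncomputable def cnotBlockProducts (n : ℕ) : ℕ → Set (QMatrix n)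
  | 0 => {1}
  | k + 1 => ⋃ q : Fin n × Fin n,
      {C | ∃ A ∈ cnotBlockProducts n k, ∃ B ∈ Set.range (cnotBlock q.1 q.2), A * B = C}

theorem contDiff_oneQubitMatrix {n : ℕ} (q : Fin n) {E : Type*} [NormedAddCommGroup E]
    [NormedSpace ℝ E] {f : E → Matrix (Fin 2) (Fin 2) ℂ}
    (hf : ∀ i j, ContDiff ℝ 1 fun p => f p i j) (x y : Fin n → Fin 2) :
    ContDiff ℝ 1 fun p => oneQubitMatrix q (f p) x y := by
  simp only [oneQubitMatrix, Matrix.of_apply]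
  split_ifs
  · exact hf _ _
  · exact contDiff_const

theorem smoothlyCovered_range_cnotBlock {n : ℕ} (c t : Fin n) :
    SmoothlyCovered 4 (Set.range (cnotBlock c t)) := by
  have h (i j : Fin 4) (x y : Fin 2) :
      ContDiff ℝ 1 fun p : Fin 4 → ℝ => (phaseGate (p i) * rotationGate (p j)) x y :=
    contDiff_matrix_mul
      (fun x y => (contDiff_phaseGate x y).comp
        (by fun_prop : ContDiff ℝ 1 fun p : Fin 4 → ℝ => p i))
      (fun x y => (contDiff_rotationGate x y).comp
        (by fun_prop : ContDiff ℝ 1 fun p : Fin 4 → ℝ => p j)) x y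
  refine SmoothlyCovered.range (by simp) _ ?_
  unfold cnotBlock
  refine contDiff_matrix_mul (contDiff_matrix_mul (contDiff_oneQubitMatrix c (h 0 1))
    (contDiff_oneQubitMatrix t ?_)) fun _ _ => contDiff_const
  exact contDiff_matrix_mul (contDiff_matrix_mul (fun _ _ => contDiff_const) (h 2 3))
    fun _ _ => contDiff_const

theorem smoothlyCovered_cnotBlockProducts (n k : ℕ) :
    SmoothlyCovered (4 * k) (cnotBlockProducts n k) := by
  induction k with
  | zero => exact SmoothlyCovered.singleton 1
  | succ k ih =>
    exact SmoothlyCovered.iUnion fun q => ih.mul (smoothlyCovered_range_cnotBlock q.1 q.2)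

/-- The tensor products of the one-qubit operators `phaseGate α * rotationGate β * phaseGate γ`. -/
noncomputable def localFamily (n : ℕ) (p : Fin n × Fin 3 → ℝ) : QMatrix n :=
  tensorMatrix fun q => phaseGate (p (q, 0)) * rotationGate (p (q, 1)) * phaseGate (p (q, 2))

theorem smoothlyCovered_range_localFamily (n : ℕ) :
    SmoothlyCovered (3 * n) (Set.range (localFamily n)) := by
  refine SmoothlyCovered.range (by simp [mul_comm]) _ fun x y => ?_
  simp only [localFamily, tensorMatrix, Matrix.of_apply]
  refine contDiff_prod fun q _ => contDiff_matrix_mul (contDiff_matrix_mul ?_ ?_) ?_ _ _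
  · exact fun x y => (contDiff_phaseGate x y).comp
      (by fun_prop : ContDiff ℝ 1 fun p : Fin n × Fin 3 → ℝ => p (q, 0))
  · exact fun x y => (contDiff_rotationGate x y).comp
      (by fun_prop : ContDiff ℝ 1 fun p : Fin n × Fin 3 → ℝ => p (q, 1))
  · exact fun x y => (contDiff_phaseGate x y).comp
      (by fun_prop : ContDiff ℝ 1 fun p : Fin n × Fin 3 → ℝ => p (q, 2))

theorem exists_tensorMatrix_eq_smul_localFamily {n : ℕ} {a : Fin n → Matrix (Fin 2) (Fin 2) ℂ}
    (ha : ∀ q, a q ∈ Matrix.unitaryGroup (Fin 2) ℂ) :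
    ∃ (z : ℂ) (p : Fin n × Fin 3 → ℝ), ‖z‖ = 1 ∧ tensorMatrix a = z • localFamily n p := by
  choose w α β γ hw h using fun q => exists_eq_smul_phaseGate_mul (ha q)
  refine ⟨∏ q, w q, fun r => ![α r.1, β r.1, γ r.1] r.2, by simp [hw], ?_⟩
  rw [localFamily, ← tensorMatrix_smul]
  exact congrArg tensorMatrix (funext h)

/-- A variant of `exists_eq_smul_phaseGate_mul` whose right factor commutes with the target of a
`CNOT`. -/
theorem exists_eq_smul_hadamardGate_mul {a : Matrix (Fin 2) (Fin 2) ℂ}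
    (ha : a ∈ Matrix.unitaryGroup (Fin 2) ℂ) :
    ∃ (w : ℂ) (α β γ : ℝ), ‖w‖ = 1 ∧
      a = w • (hadamardGate * (phaseGate α * rotationGate β) * hadamardGate *
        (hadamardGate * phaseGate γ * hadamardGate)) := by
  obtain ⟨w, α, β, γ, hw, h⟩ := exists_eq_smul_phaseGate_mul
    (mul_mem (mul_mem hadamardGate_mem_unitaryGroup ha) hadamardGate_mem_unitaryGroup)
  refine ⟨w, α, β, γ, hw, ?_⟩
  calc a = hadamardGate * hadamardGate * a * (hadamardGate * hadamardGate) := by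
        simp [hadamardGate_mul_self]
    _ = hadamardGate * (hadamardGate * a * hadamardGate) * hadamardGate := by
        simp only [Matrix.mul_assoc]
    _ = w • (hadamardGate * (phaseGate α * rotationGate β) * (hadamardGate * hadamardGate) *
          (phaseGate γ * hadamardGate)) := by
        rw [h, hadamardGate_mul_self]
        simp only [Matrix.mul_assoc, Matrix.mul_smul, Matrix.smul_mul, Matrix.one_mul]
    _ = _ := by simp only [Matrix.mul_assoc]

theorem hadamardGate_conj_phaseGate_apply_add (γ : ℝ) (i j s : Fin 2) :
    (hadamardGate * phaseGate γ * hadamardGate) i (j + s) =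
      (hadamardGate * phaseGate γ * hadamardGate) (i + s) j := by
  fin_cases i <;> fin_cases j <;> fin_cases s <;>
    simp [hadamardGate, phaseGate, Matrix.mul_apply]

theorem exists_tensorMatrix_mul_cnotMatrix {n : ℕ} {c t : Fin n} (hct : c ≠ t)
    {a : Fin n → Matrix (Fin 2) (Fin 2) ℂ} (ha : ∀ q, a q ∈ Matrix.unitaryGroup (Fin 2) ℂ) :
    ∃ (z : ℂ) (p : Fin 4 → ℝ) (b : Fin n → Matrix (Fin 2) (Fin 2) ℂ), ‖z‖ = 1 ∧
      (∀ q, b q ∈ Matrix.unitaryGroup (Fin 2) ℂ) ∧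
      tensorMatrix a * cnotMatrix c t = z • (cnotBlock c t p * tensorMatrix b) := by
  obtain ⟨w, α, β, γ, hw, hc⟩ := exists_eq_smul_phaseGate_mul (ha c)
  obtain ⟨w', α', β', γ', hw', ht⟩ := exists_eq_smul_hadamardGate_mul (ha t)
  -- The factors that pass through the `CNOT`: the third Euler factor on control and target,
  -- everything on the other qubits.
  let b := Function.update (Function.update a c (phaseGate γ)) t
    (hadamardGate * phaseGate γ' * hadamardGate)
  have hbc : b c = phaseGate γ := by simp [b, Function.update_of_ne hct]
  have hbt : b t = hadamardGate * phaseGate γ' * hadamardGate := by simp [b]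
  have hbq : ∀ q, q ≠ c → q ≠ t → b q = a q := fun q h1 h2 => by
    simp [b, Function.update_of_ne h1, Function.update_of_ne h2]
  have hsplit : tensorMatrix a = (w * w') • (oneQubitMatrix c (phaseGate α * rotationGate β) *
      oneQubitMatrix t (hadamardGate * (phaseGate α' * rotationGate β') * hadamardGate) *
      tensorMatrix b) := by
    have hprod : ∏ q, (Function.update (Function.update (fun _ : Fin n => (1 : ℂ)) c w) t w') q =
        w * w' := by
      rw [Finset.prod_update_of_mem (Finset.mem_univ t), Finset.prod_update_of_mem (by simp [hct])]
      simp [mul_comm]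
    rw [oneQubitMatrix_eq_tensorMatrix, oneQubitMatrix_eq_tensorMatrix, tensorMatrix_mul,
      tensorMatrix_mul, ← hprod, ← tensorMatrix_smul]
    congr 1
    funext q
    by_cases h2 : q = t
    · subst h2
      simp only [Function.update_self, Function.update_of_ne hct.symm, one_mul, hbt]
      exact ht
    · by_cases h1 : q = c
      · subst h1
        simp only [Function.update_self, Function.update_of_ne hct, mul_one, hbc]
        exact hc
      · simp [Function.update_of_ne h1, Function.update_of_ne h2, hbq q h1 h2]
  refine ⟨w * w', ![α, β, α', β'], b, by simp [hw, hw'], fun q => ?_, ?_⟩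
  · by_cases h2 : q = t
    · rw [h2, hbt]
      exact mul_mem (mul_mem hadamardGate_mem_unitaryGroup (phaseGate_mem_unitaryGroup _))
        hadamardGate_mem_unitaryGroup
    · by_cases h1 : q = c
      · rw [h1, hbc]
        exact phaseGate_mem_unitaryGroup _
      · rw [hbq q h1 h2]
        exact ha q
  · have hcomm : tensorMatrix b * cnotMatrix c t = cnotMatrix c t * tensorMatrix b := by
      refine tensorMatrix_mul_cnotMatrix_comm hct (fun i j hij => ?_) fun i j s => ?_
      · rw [hbc]
        fin_cases i <;> fin_cases j <;> simp_all [phaseGate]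
      · rw [hbt, hadamardGate_conj_phaseGate_apply_add]
    rw [hsplit, Matrix.smul_mul, Matrix.mul_assoc _ (tensorMatrix b), hcomm, ← Matrix.mul_assoc]
    rfl

/-- The head of the list multiplies on the right, next to the local layer: a one-qubit gate merges
into that layer, and a `CNOT` splits off a block and leaves a new layer behind it. -/
theorem QCircuit.exists_toMatrix_eq {n : ℕ} (C : QCircuit n) :
    ∃ (z : ℂ) (M : QMatrix n) (a : Fin n → Matrix (Fin 2) (Fin 2) ℂ), ‖z‖ = 1 ∧
      M ∈ cnotBlockProducts n C.cnotCount ∧ (∀ q, a q ∈ Matrix.unitaryGroup (Fin 2) ℂ) ∧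
      C.toMatrix = z • (M * tensorMatrix a) := by
  induction C with
  | nil =>
    exact ⟨1, 1, fun _ => 1, by simp, rfl, fun _ => one_mem _, by
      simp [QCircuit.toMatrix, tensorMatrix_one]⟩
  | cons g C ih =>
    obtain ⟨z, M, a, hz, hM, ha, h⟩ := ih
    cases g with
    | oneQubit q b =>
      refine ⟨z, M, fun r => a r * (Function.update (fun _ => 1) q b.1 :
        Fin n → Matrix (Fin 2) (Fin 2) ℂ) r, hz, hM, fun r => ?_, ?_⟩
      · refine mul_mem (ha r) ?_
        by_cases hr : r = q
        · subst hr; simp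
        · rw [Function.update_of_ne hr]; exact one_mem _
      · rw [QCircuit.toMatrix, h, QGate.toMatrix, oneQubitMatrix_eq_tensorMatrix,
          Matrix.smul_mul, Matrix.mul_assoc, tensorMatrix_mul]
    | cnot c t hct =>
      obtain ⟨z', p, b, hz', hb, h'⟩ := exists_tensorMatrix_mul_cnotMatrix hct ha
      refine ⟨z * z', M * cnotBlock c t p, b, by simp [hz, hz'], ?_, hb, ?_⟩
      · exact Set.mem_iUnion.2 ⟨(c, t), M, hM, _, ⟨p, rfl⟩, rfl⟩
      · rw [QCircuit.toMatrix, h, QGate.toMatrix, Matrix.smul_mul, Matrix.mul_assoc, h',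
          Matrix.mul_smul, smul_smul, Matrix.mul_assoc]

/-! ### Operators that agree after a measurement -/

theorem inner_applyOp {n : ℕ} (u : QMatrix n) (φ ψ : QState n) :
    inner ℂ φ (applyOp u ψ) = inner ℂ (applyOp uᴴ φ) ψ := by
  simp only [EuclideanSpace.inner_eq_star_dotProduct, applyOp]
  rw [Matrix.star_mulVec, Matrix.conjTranspose_conjTranspose, dotProduct_comm,
    dotProduct_comm _ (_ ᵥ* _), Matrix.dotProduct_mulVec]

theorem norm_applyOp {n : ℕ} {u : QMatrix n} (hu : uᴴ * u = 1) (ψ : QState n) :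
    ‖applyOp u ψ‖ = ‖ψ‖ := by
  have h : inner ℂ (applyOp u ψ) (applyOp u ψ) = inner ℂ ψ ψ := by
    rw [inner_applyOp]
    simp [applyOp, hu]
  rw [@norm_eq_sqrt_re_inner ℂ, @norm_eq_sqrt_re_inner ℂ, h]

theorem exists_orthonormalBasis_of_isOrthogonalDecomposition {n : ℕ} {ι : Type*}
    {E : ι → Submodule ℂ (QState n)} (hE : IsOrthogonalDecomposition E)
    (hdim : ∀ i, Module.finrank ℂ (E i) = 1) :
    ∃ (b : OrthonormalBasis (Fin n → Fin 2) ℂ (QState n)) (σ : (Fin n → Fin 2) → ι),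
      ∀ j, E (σ j) = ℂ ∙ b j := by
  have hv : ∀ i, ∃ v : QState n, ‖v‖ = 1 ∧ E i = ℂ ∙ v := by
    intro i
    obtain ⟨v, hv0, hv⟩ := finrank_eq_one_iff'.1 (hdim i)
    have hv0' : (v : QState n) ≠ 0 := by simpa using hv0
    have hEi : E i = ℂ ∙ (v : QState n) := by
      refine le_antisymm (fun x hx => ?_) ((Submodule.span_singleton_le_iff_mem _ _).2 v.2)
      obtain ⟨c, hc⟩ := hv ⟨x, hx⟩
      exact Submodule.mem_span_singleton.2 ⟨c, congrArg Subtype.val hc⟩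
    refine ⟨((‖(v : QState n)‖ : ℂ)⁻¹) • (v : QState n), ?_, ?_⟩
    · simp [norm_smul, hv0']
    · refine hEi.trans (Submodule.span_singleton_smul_eq ?_ _).symm
      simpa using hv0'
  choose v hv1 hv using hv
  have hon : Orthonormal ℂ v := ⟨hv1, fun i j hij =>
    (Submodule.isOrtho_iff_inner_eq.1 (hE.1 i j hij)) _ (by simp [hv]) _ (by simp [hv])⟩
  have hsp : ⊤ ≤ Submodule.span ℂ (Set.range v) := by
    rw [← hE.2, iSup_le_iff]
    intro i
    rw [hv i]
    exact Submodule.span_mono (by simp)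
  have : Finite ι := hon.linearIndependent.finite
  have : Fintype ι := Fintype.ofFinite ι
  let b := OrthonormalBasis.mk hon hsp
  have hcard : Fintype.card ι = Fintype.card (Fin n → Fin 2) := by
    rw [← Module.finrank_eq_card_basis b.toBasis, finrank_euclideanSpace]
  let σ := Fintype.equivOfCardEq hcard
  refine ⟨b.reindex σ, σ.symm, fun j => ?_⟩
  simp [b, hv]

theorem measureProb_span_singleton {n : ℕ} {v : QState n} (hv : ‖v‖ = 1) (ψ : QState n) :
    measureProb (ℂ ∙ v) ψ = ‖inner ℂ v ψ‖ ^ 2 := by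
  rw [measureProb, Submodule.starProjection_unit_singleton ℂ hv, norm_smul, hv, mul_one]

/-- The unitary operators that are diagonal in the orthonormal basis `b`. -/
noncomputable def diagonalFamily {n : ℕ} (b : OrthonormalBasis (Fin n → Fin 2) ℂ (QState n))
    (φ : (Fin n → Fin 2) → ℝ) : QMatrix n :=
  ∑ j, Complex.exp (φ j * Complex.I) • Matrix.vecMulVec (b j).ofLp (star (b j).ofLp)

theorem smoothlyCovered_range_diagonalFamily {n : ℕ}
    (b : OrthonormalBasis (Fin n → Fin 2) ℂ (QState n)) :
    SmoothlyCovered (2 ^ n) (Set.range (diagonalFamily b)) := by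
  refine SmoothlyCovered.range (by simp) _ fun x y => ?_
  simp only [diagonalFamily, Matrix.sum_apply, Matrix.smul_apply, smul_eq_mul]
  exact ContDiff.sum fun j _ => (contDiff_cexp_mul_I.comp
    (by fun_prop : ContDiff ℝ 1 fun φ : (Fin n → Fin 2) → ℝ => φ j)).mul contDiff_const

theorem sum_vecMulVec_orthonormalBasis {n : ℕ}
    (b : OrthonormalBasis (Fin n → Fin 2) ℂ (QState n)) :
    ∑ j, Matrix.vecMulVec (b j).ofLp (star (b j).ofLp) = 1 := by
  ext x y
  have h := b.sum_inner_mul_inner (EuclideanSpace.single x (1 : ℂ)) (EuclideanSpace.single y 1)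
  simp only [EuclideanSpace.inner_single_left, EuclideanSpace.inner_single_right, map_one,
    one_mul] at h
  simp only [Matrix.sum_apply, Matrix.vecMulVec_apply, Pi.star_apply, RCLike.star_def, h]
  simp [Matrix.one_apply, eq_comm]

/-- Testing on `ψ = uᴴ b_j` gives equality in Cauchy–Schwarz for `wᴴ b_j` and `uᴴ b_j`, so these
unit vectors differ by a phase for each `j`. These phases are the diagonal entries, and they absorb
`z`. -/
theorem exists_eq_diagonalFamily_mul {n : ℕ} (b : OrthonormalBasis (Fin n → Fin 2) ℂ (QState n))
    {u w : QMatrix n} (hu : u ∈ Matrix.unitaryGroup (Fin n → Fin 2) ℂ)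
    (hw : w ∈ Matrix.unitaryGroup (Fin n → Fin 2) ℂ)
    (h : ∀ ψ, ‖ψ‖ = 1 → ∀ j, ‖inner ℂ (b j) (applyOp w ψ)‖ = ‖inner ℂ (b j) (applyOp u ψ)‖)
    {z : ℂ} (hz : ‖z‖ = 1) : ∃ φ, u = diagonalFamily b φ * (z • w) := by
  have hnorm : ∀ {v : QMatrix n}, v ∈ Matrix.unitaryGroup (Fin n → Fin 2) ℂ → ∀ j,
      ‖applyOp vᴴ (b j)‖ = 1 := fun hv j => by
    rw [norm_applyOp (by rw [Matrix.conjTranspose_conjTranspose]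
                         exact Matrix.mem_unitaryGroup_iff.1 hv), b.norm_eq_one]
  have hrow : ∀ j, ∃ θ : ℝ, star (b j).ofLp ᵥ* u =
      Complex.exp (θ * Complex.I) • (star (b j).ofLp ᵥ* (z • w)) := by
    intro j
    have hin : ‖inner ℂ (applyOp wᴴ (b j)) (applyOp uᴴ (b j))‖ =
        ‖applyOp wᴴ (b j)‖ * ‖applyOp uᴴ (b j)‖ := by
      rw [← inner_applyOp, h _ (hnorm hu j), inner_applyOp, inner_self_eq_norm_sq_to_K,
        hnorm hu, hnorm hw]
      simp
    obtain ⟨r, -, hr⟩ := (norm_inner_eq_norm_iff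
      (norm_ne_zero_iff.1 (by rw [hnorm hw]; norm_num))
      (norm_ne_zero_iff.1 (by rw [hnorm hu]; norm_num))).1 hin
    have hr1 : ‖r‖ = 1 := by
      have := congrArg norm hr
      rwa [norm_smul, hnorm hu, hnorm hw, mul_one, eq_comm] at this
    have hs : star r = (star r * z⁻¹) * z := by
      rw [mul_assoc, inv_mul_cancel₀ (norm_ne_zero_iff.1 (by rw [hz]; norm_num)), mul_one]
    have hs1 : ‖star r * z⁻¹‖ = 1 := by simp [hr1, hz]
    refine ⟨(star r * z⁻¹).arg, ?_⟩
    have he : Complex.exp ((star r * z⁻¹).arg * Complex.I) = star r * z⁻¹ := by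
      have := Complex.norm_mul_exp_arg_mul_I (star r * z⁻¹)
      rwa [hs1, Complex.ofReal_one, one_mul] at this
    rw [he, Matrix.vecMul_smul, smul_smul, ← hs]
    have h2 : uᴴ *ᵥ (b j).ofLp = r • (wᴴ *ᵥ (b j).ofLp) := congrArg WithLp.ofLp hr
    have h3 := congrArg star h2
    rwa [Matrix.star_mulVec, Matrix.conjTranspose_conjTranspose, star_smul, Matrix.star_mulVec,
      Matrix.conjTranspose_conjTranspose] at h3
  choose φ hφ using hrow
  refine ⟨φ, ?_⟩
  calc u = (∑ j, Matrix.vecMulVec (b j).ofLp (star (b j).ofLp)) * u := by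
        rw [sum_vecMulVec_orthonormalBasis, Matrix.one_mul]
    _ = _ := by
        rw [diagonalFamily, Finset.sum_mul, Finset.sum_mul]
        refine Finset.sum_congr rfl fun j _ => ?_
        rw [Matrix.vecMulVec_mul, hφ j, Matrix.smul_mul, Matrix.vecMulVec_mul,
          Matrix.vecMulVec_smul]

theorem mainTheorem7 (n : ℕ) {ι : Type*} (E : ι → Submodule ℂ (QState n))
    (hE : IsOrthogonalDecomposition E) (hdim : ∀ i, Module.finrank ℂ (E i) = 1) :
    ∃ u ∈ Matrix.unitaryGroup (Fin n → Fin 2) ℂ,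
      ∀ C : QCircuit n, C.SimulatesUpToMeasurement E u →
        ⌈((4 : ℚ) ^ n - 2 ^ n - 3 * (n : ℚ)) / 4⌉ ≤ (C.cnotCount : ℤ) := by
  by_contra! hcon
  obtain ⟨b, σ, hb⟩ := exists_orthonormalBasis_of_isOrthogonalDecomposition hE hdim
  -- Exactly the `CNOT` counts below the claimed bound.
  let K := {k : ℕ // 2 ^ n + 4 * k + 3 * n < 4 ^ n}
  let S : K → Set (QMatrix n) := fun k =>
    {U | ∃ A ∈ {A | ∃ D ∈ Set.range (diagonalFamily b), ∃ M ∈ cnotBlockProducts n k.1, D * M = A},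
      ∃ B ∈ Set.range (localFamily n), A * B = U}
  have hS : ∀ k, SmoothlyCovered (2 ^ n + 4 * k.1 + 3 * n) (S k) := fun k =>
    ((smoothlyCovered_range_diagonalFamily b).mul (smoothlyCovered_cnotBlockProducts n k.1)).mul
      (smoothlyCovered_range_localFamily n)
  have hle := SmoothlyCovered.card_sq_le hS (d := 4 ^ n - 1)
    (fun k => Nat.le_sub_one_of_lt k.2) fun u hu => by
    obtain ⟨C, ⟨w, hw, hagree, θ, hC⟩, hlt⟩ := hcon u hu
    have hk : 2 ^ n + 4 * C.cnotCount + 3 * n < 4 ^ n := by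
      rw [Int.lt_ceil, lt_div_iff₀ (by norm_num), lt_sub_iff_add_lt, lt_sub_iff_add_lt] at hlt
      have : (2 ^ n + 4 * C.cnotCount + 3 * n : ℚ) < 4 ^ n := by
        push_cast at hlt
        linarith
      exact_mod_cast this
    obtain ⟨z, M, a, hz, hM, ha, hCz⟩ := C.exists_toMatrix_eq
    obtain ⟨z', p, hz', hap⟩ := exists_tensorMatrix_eq_smul_localFamily ha
    have hinner : ∀ ψ, ‖ψ‖ = 1 → ∀ j,
        ‖inner ℂ (b j) (applyOp w ψ)‖ = ‖inner ℂ (b j) (applyOp u ψ)‖ := fun ψ hψ j => by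
      have := hagree ψ hψ (σ j)
      rw [hb, measureProb_span_singleton (b.norm_eq_one j),
        measureProb_span_singleton (b.norm_eq_one j)] at this
      exact (pow_left_inj₀ (norm_nonneg _) (norm_nonneg _) two_ne_zero).1 this
    -- The scalar makes `z • w` equal to `M * localFamily n p`, with no phase left to parametrize.
    obtain ⟨φ, hφ⟩ := exists_eq_diagonalFamily_mul b hu hw hinner
      (z := (z * z')⁻¹ * Complex.exp (θ * Complex.I))
      (by simp [hz, hz', Complex.norm_exp_ofReal_mul_I])
    have hzz : z * z' ≠ 0 := norm_ne_zero_iff.1 (by simp [hz, hz'])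
    refine ⟨⟨C.cnotCount, hk⟩, _, ⟨_, ⟨φ, rfl⟩, M, hM, rfl⟩, _, ⟨p, rfl⟩, ?_⟩
    rw [hφ, mul_smul, ← hC, hCz, hap, Matrix.mul_smul M, smul_smul, smul_smul, mul_assoc _ z,
      inv_mul_cancel₀ hzz, one_smul, Matrix.mul_assoc]
  have hcard : Fintype.card (Fin n → Fin 2) ^ 2 = 4 ^ n := by
    rw [Fintype.card_fun, Fintype.card_fin, Fintype.card_fin, ← pow_mul, mul_comm, pow_mul]
    norm_num
  rw [hcard] at hle
  have : 0 < 4 ^ n := by positivity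
  omega
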